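/- Let $\sigma$ be a finite algebraic signature; algebras are nonempty $\sigma$-algebras. A pseudovariety is a nonempty class of finite algebras closed under homomorphic images, subalgebras and finite direct products. For a pseudovariety $\mathsf V$ and a finite set $A$, $\Omega_A\mathsf V$ denotes the free pro-$\mathsf V$ algebra over $A$; its elements are identified with the $A$-ary implicit operations on $\mathsf V$, i.e. the families $w=(w_S)_{S\in\mathsf V}$ of operations $w_S:S^A\to S$ that commute with all homomorphisms between members of $\mathsf V$, with the topology of pointwise convergence. The finite alphabets $A$ below are those over which there are $\sigma$-terms: $A\ne\emptyset$ or $\sigma$ has a constant symbol. Let $\mathsf U$ be a pseudovariety, $\tau$ a computable implicit signature over $\mathsf U$ (an effectively enumerated set of computable implicit operations of finite arities on $\mathsf U$, including the basic operations), and $\mathsf V\subseteq\mathsf U$ a recursively enumerable pseudovariety. Every operation in $\tau$ has a natural interpretation in each member of $\mathsf U$ and in $\Omega_A\mathsf U$ and $\Omega_A\mathsf V$; let $\Omega_A^\tau\mathsf V$ be the $\tau$-subalgebra of $\Omega_A\mathsf V$ generated by $A$. The word problem for $\Omega_A^\tau\mathsf V$ is: given two $\tau$-terms over $A$, decide whether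 they represent the same element of $\Omega_A^\tau\mathsf V$. Let $\pi:\Omega_A\mathsf U\to\Omega_A\mathsf V$ be the continuous homomorphism fixing the generators. * For $S\in\mathsf U$ generated by the image of a mapping $\varphi:A\to S$, with continuous extension $\hat\varphi:\Omega_A\mathsf U\to S$, put $\mu_{\mathsf V,A}=\{(\hat\varphi(w),\pi(w)) : w\in\Omega_A\mathsf U\}$, let $\bar\mu^\tau_{\mathsf V,A}=\mu_{\mathsf V,A}\cap(S\times\Omega_A^\tau\mathsf V)$, and let $\mu^\tau_{\mathsf V,A}$ be the $\tau$-subalgebra of $S\times\Omega_A^\tau\mathsf V$ generated by the pairs $(\varphi(a),a)$, $a\in A$. $\mathsf V$ is $\tau$-full if $\bar\mu^\tau_{\mathsf V,A}=\mu^\tau_{\mathsf V,A}$ for all finite $A$ and all $A$-generated $S\in\mathsf U$. * A constrained system consists of a finite set $X$ of variables, a set of equations $u=v$ with $u,v\in\Omega_X\mathsf U$, a finite alphabet $A$, and clopen constraints $K_x\subseteq\Omega_A\mathsf U$ ($x\in X$). A solution of it in $\Omega_A\mathsf V$ is a mapping $\gamma:X\to\Omega_A\mathsf U$ with $\gamma(x)\in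 K_x$ for all $x\in X$ and $\pi(\hat\gamma(u))=\pi(\hat\gamma(v))$ for every equation $u=v$, where $\hat\gamma:\Omega_X\mathsf U\to\Omega_A\mathsf U$ is the continuous homomorphism extending $\gamma$. $\mathsf V$ is completely $\tau$-tame if (i) every constrained system of finitely many equations between $\tau$-terms that has a solution in $\Omega_A\mathsf V$ has a solution $\gamma'$ in $\Omega_A\mathsf V$ with $\gamma'(X)\subseteq\Omega_A^\tau\mathsf U$, and (ii) the word problem for $\Omega_A^\tau\mathsf V$ is decidable for every finite $A$. **Proposition.** Suppose that $\Omega_A\mathsf V=\Omega_A^\tau\mathsf V$ for every finite set $A$ and that $\mathsf V$ is $\tau$-full. Then $\mathsf V$ is completely $\tau$-tame if and only if the word problem for $\Omega_A^\tau\mathsf V$ is decidable for every finite set $A$. -/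

import Mathlib

namespace ImplicitTame

/-! ### General algebra -/

/-- An algebraic signature: operation symbols with their (finite) arities. -/
structure Signature where
  /-- the operation symbols -/
  Op : Type
  /-- the arity function -/
  arity : Op → ℕ

/-- An interpretation of the operation symbols of `σ` on the set `T`. -/
abbrev Interp (σ : Signature) (T : Type) : Type :=
  ∀ f : σ.Op, (Fin (σ.arity f) → T) → T

/-- Formal `σ`-terms over the alphabet `A`. -/
inductive Term (σ : Signature) (A : Type) : Type
  | var (a : A) : Term σ A
  | app (f : σ.Op) (ts : Fin (σ.arity f) → Term σ A) : Term σ A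

/-- The value of a term under an assignment of its letters. -/
def Term.eval {σ : Signature} {A T : Type} (I : Interp σ T) (φ : A → T) : Term σ A → T
  | .var a => φ a
  | .app f ts => I f fun j => (ts j).eval I φ

/-- A term written as a word (in prefix, i.e. Polish, notation) over the letters and the operation
symbols; this is the form in which terms are given to algorithms. Distinct terms have distinct
words, because every operation symbol has a fixed arity. -/
def Term.word {σ : Signature} {A : Type} : Term σ A → List (A ⊕ σ.Op)
  | .var a => [Sum.inl a]
  | .app f ts => Sum.inr f :: (List.ofFn fun j => (ts j).word).flatten

/-- The subalgebra of `(T, I)` generated by the set `X`. -/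
inductive Generated {σ : Signature} {T : Type} (I : Interp σ T) (X : Set T) : T → Prop
  | base {t : T} (ht : t ∈ X) : Generated I X t
  | app (f : σ.Op) (ts : Fin (σ.arity f) → T) (h : ∀ j, Generated I X (ts j)) :
      Generated I X (I f ts)

/-- A finite (nonempty) `σ`-algebra. Up to isomorphism its underlying set is `{0, …, k}`. -/
structure FinAlg (σ : Signature) where
  /-- the number of elements, minus one -/
  last : ℕ
  /-- the basic operations -/
  op : Interp σ (Fin (last + 1))

/-- The underlying set of a finite algebra. -/
abbrev FinAlg.Carrier {σ : Signature} (S : FinAlg σ) : Type := Fin (S.last + 1)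

/-- Homomorphisms between finite algebras. -/
def IsHom {σ : Signature} (S T : FinAlg σ) (h : S.Carrier → T.Carrier) : Prop :=
  ∀ (f : σ.Op) (s : Fin (σ.arity f) → S.Carrier), h (S.op f s) = T.op f fun j => h (s j)

/-- A pseudovariety: a nonempty class of finite algebras closed under homomorphic images,
subalgebras and finite direct products (all up to isomorphism; the empty product, which is a
trivial algebra, is a homomorphic image of any member). -/
structure IsPseudovariety {σ : Signature} (V : Set (FinAlg σ)) : Prop where
  nonempty : V.Nonempty
  image : ∀ (S T : FinAlg σ) (h : S.Carrier → T.Carrier),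
    S ∈ V → IsHom S T h → Function.Surjective h → T ∈ V
  sub : ∀ (S T : FinAlg σ) (h : S.Carrier → T.Carrier),
    T ∈ V → IsHom S T h → Function.Injective h → S ∈ V
  prod : ∀ (P S T : FinAlg σ) (p : P.Carrier → S.Carrier) (q : P.Carrier → T.Carrier),
    S ∈ V → T ∈ V → IsHom P S p → IsHom P T q →
    Function.Bijective (fun x => (p x, q x)) → P ∈ V

/-- The `n`-letter alphabet admits free algebras: the set of `σ`-terms over it is nonempty, that
is, `n ≠ 0` or there is a constant symbol. (Algebras are nonempty by definition.) -/
def Admissible (σ : Signature) (n : ℕ) : Prop := Nonempty (Term σ (Fin n))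

/-- `S` is generated, as a `σ`-algebra, by the images of the letters under `φ`. -/
def Generates {σ : Signature} {n : ℕ} (S : FinAlg σ) (φ : Fin n → S.Carrier) : Prop :=
  ∀ s : S.Carrier, Generated S.op (Set.range φ) s

/-! ### Free profinite algebras, as algebras of implicit operations -/

/-- `Ω_n V`, the free pro-`V` algebra over the `n`-letter alphabet `Fin n`, whose elements are the
`n`-ary implicit operations on `V`: the families of operations `w_S : S^n → S`, `S ∈ V`, which
commute with all homomorphisms between members of `V`. It is used for alphabets over which there
are terms. (On finite algebras, operations of finite arity are automatically continuous.) -/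
def Omega {σ : Signature} (V : Set (FinAlg σ)) (n : ℕ) : Type :=
  {w : ∀ S : V, (Fin n → S.1.Carrier) → S.1.Carrier //
    ∀ (S T : V) (h : S.1.Carrier → T.1.Carrier), IsHom S.1 T.1 h →
      ∀ φ : Fin n → S.1.Carrier, w T (fun a => h (φ a)) = h (w S φ)}

/-- The profinite topology of `Ω_n V`: pointwise convergence, the members of `V` being discrete. -/
instance {σ : Signature} (V : Set (FinAlg σ)) (n : ℕ) : TopologicalSpace (Omega V n) :=
  instTopologicalSpaceSubtype

namespace Omega

variable {σ : Signature} {U V : Set (FinAlg σ)} {m n : ℕ}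

/-- The interpretation `w_S` of an implicit operation in `S ∈ V`; equivalently, `w.on S hS φ` is
the image of `w` under the continuous homomorphism `Ω_n V → S` which extends `φ`. -/
def on (w : Omega V n) (S : FinAlg σ) (hS : S ∈ V) (φ : Fin n → S.Carrier) : S.Carrier :=
  w.1 ⟨S, hS⟩ φ

/-- The free generators: the projections. -/
def gen (V : Set (FinAlg σ)) (a : Fin n) : Omega V n :=
  ⟨fun _ φ => φ a, fun _ _ _ _ _ => rfl⟩

/-- The basic operations, as implicit operations. -/
def basic (V : Set (FinAlg σ)) (f : σ.Op) : Omega V (σ.arity f) :=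
  ⟨fun S φ => S.1.op f φ, fun _ _ _ hh φ => (hh f φ).symm⟩

/-- The interpretation of the implicit operation `w` on `U` in the pro-`U` algebra `Ω_n V`, for
`V ⊆ U`, evaluated at `γ`. In other words, `w.subst hVU γ` is the image of `w` under the
continuous homomorphism `Ω_m U → Ω_n V` which extends `γ`. -/
def subst (hVU : V ⊆ U) (w : Omega U m) (γ : Fin m → Omega V n) : Omega V n :=
  ⟨fun S φ => w.1 ⟨S.1, hVU S.2⟩ fun x => (γ x).1 S φ, fun S T h hh φ => by
    have e := funext fun x => (γ x).2 S T h hh φ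
    exact (congrArg (w.1 ⟨T.1, hVU T.2⟩) e).trans
      (w.2 ⟨S.1, hVU S.2⟩ ⟨T.1, hVU T.2⟩ h hh _)⟩

/-- The natural continuous homomorphism `Ω_n U → Ω_n V`, for `V ⊆ U`. -/
def proj (hVU : V ⊆ U) (w : Omega U n) : Omega V n :=
  ⟨fun S φ => w.1 ⟨S.1, hVU S.2⟩ φ, fun S T h hh φ =>
    w.2 ⟨S.1, hVU S.2⟩ ⟨T.1, hVU T.2⟩ h hh φ⟩

end Omega

/-! ### Effectiveness for finite algebras -/

/-- Finite presentations by which finite algebras are given to algorithms: the number of elements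
and a list of entries (symbol, arguments, value). -/
abbrev AlgCode (σ : Signature) : Type := ℕ × List (σ.Op × List ℕ × ℕ)

/-- The code `c` presents `S`: it gives its size and its complete multiplication tables. -/
def Presents {σ : Signature} (c : AlgCode σ) (S : FinAlg σ) : Prop :=
  c.1 = S.last + 1 ∧
  ∀ (f : σ.Op) (l : List ℕ) (v : ℕ), (f, l, v) ∈ c.2 ↔
    ∃ s : Fin (σ.arity f) → S.Carrier,
      l = List.ofFn (fun j => (s j : ℕ)) ∧ v = (S.op f s : ℕ)

/-- A class of finite algebras is recursively enumerable. -/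
def IsRecEnum {σ : Signature} [Primcodable σ.Op] (V : Set (FinAlg σ)) : Prop :=
  REPred fun c : AlgCode σ => ∃ S ∈ V, Presents c S

/-! ### Implicit signatures -/

/-- An indexed set of implicit operations on `U` (of finite arities). -/
structure ImplicitSignature {σ : Signature} (U : Set (FinAlg σ)) extends Signature where
  /-- the implicit operation named by a symbol -/
  operation : ∀ i : Op, Omega U (arity i)

namespace ImplicitSignature

variable {σ : Signature} {U : Set (FinAlg σ)}

/-- A computable implicit signature over `U`: it contains the basic operations, the arity of a
symbol is computable, and there is an algorithm which, given a symbol, a member `S` of `U` and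
elements of `S`, computes the value in `S` of the operation with that symbol (so the signature is
an effectively enumerated set of computable implicit operations). -/
structure IsComputable [Primcodable σ.Op] (τ : ImplicitSignature U) [Primcodable τ.Op] :
    Prop where
  basic : ∀ f : σ.Op, ∃ i : τ.Op,
    (⟨τ.arity i, τ.operation i⟩ : Σ n : ℕ, Omega U n) = ⟨σ.arity f, Omega.basic U f⟩
  arity : Computable τ.arity
  operation : ∃ F : τ.Op × AlgCode σ × List ℕ →. ℕ, Partrec F ∧
    ∀ (i : τ.Op) (S : FinAlg σ) (hS : S ∈ U) (c : AlgCode σ), Presents c S →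
      ∀ s : Fin (τ.arity i) → S.Carrier,
        (((τ.operation i).on S hS s : Fin (S.last + 1)) : ℕ) ∈
          F (i, c, List.ofFn fun j => (s j : ℕ))

/-- The `τ`-algebra structure of a member of `U`. -/
def onAlg (τ : ImplicitSignature U) (S : FinAlg σ) (hS : S ∈ U) :
    Interp τ.toSignature S.Carrier :=
  fun i s => (τ.operation i).on S hS s

/-- The `τ`-algebra structure of `Ω_n V`, for `V ⊆ U`. -/
def onOmega (τ : ImplicitSignature U) {V : Set (FinAlg σ)} (hVU : V ⊆ U) (n : ℕ) :
    Interp τ.toSignature (Omega V n) :=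
  fun i w => (τ.operation i).subst hVU w

/-- `Ω_n^τ V`, the `τ`-subalgebra of `Ω_n V` generated by the letters. -/
def omegaTau (τ : ImplicitSignature U) {V : Set (FinAlg σ)} (hVU : V ⊆ U) (n : ℕ) :
    Set (Omega V n) :=
  {w | Generated (τ.onOmega hVU n) (Set.range (Omega.gen V)) w}

/-- The word problem for `Ω_n^τ V` is decidable: there is an algorithm which, given two `τ`-terms
over the `n`-letter alphabet, decides whether they have the same value in `Ω_n^τ V`. -/
def DecidableWordProblem (τ : ImplicitSignature U) [Primcodable τ.Op] {V : Set (FinAlg σ)}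
    (hVU : V ⊆ U) (n : ℕ) : Prop :=
  ComputablePred fun p : List (Fin n ⊕ τ.Op) × List (Fin n ⊕ τ.Op) =>
    ∃ s t : Term τ.toSignature (Fin n), s.word = p.1 ∧ t.word = p.2 ∧
      s.eval (τ.onOmega hVU n) (Omega.gen V) = t.eval (τ.onOmega hVU n) (Omega.gen V)

/-! ### Relational morphisms and fullness -/

/-- The relational morphism `μ_{V,A} ⊆ S × Ω_A V` for an `A`-generated algebra `S ∈ U`, with
generating mapping `φ` and `A = Fin n`: the composite of the inverse of `Ω_A U → S` with
`Ω_A U → Ω_A V`. -/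
def mu {V : Set (FinAlg σ)} (hVU : V ⊆ U) {n : ℕ} (S : FinAlg σ) (hS : S ∈ U)
    (φ : Fin n → S.Carrier) : Set (S.Carrier × Omega V n) :=
  {p | ∃ w : Omega U n, w.on S hS φ = p.1 ∧ w.proj hVU = p.2}

/-- The intersection of `μ_{V,A}` with `S × Ω_A^τ V`. -/
def muBar (τ : ImplicitSignature U) {V : Set (FinAlg σ)} (hVU : V ⊆ U) {n : ℕ}
    (S : FinAlg σ) (hS : S ∈ U) (φ : Fin n → S.Carrier) : Set (S.Carrier × Omega V n) :=
  {p | p ∈ mu hVU S hS φ ∧ p.2 ∈ τ.omegaTau hVU n}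

/-- The `τ`-subalgebra of `S × Ω_A V` (equivalently, of `S × Ω_A^τ V`) generated by the pairs
`(a, a)` with `a ∈ A`. -/
def muTau (τ : ImplicitSignature U) {V : Set (FinAlg σ)} (hVU : V ⊆ U) {n : ℕ}
    (S : FinAlg σ) (hS : S ∈ U) (φ : Fin n → S.Carrier) : Set (S.Carrier × Omega V n) :=
  {p | Generated (σ := τ.toSignature)
    (fun i q => (τ.onAlg S hS i fun j => (q j).1, τ.onOmega hVU n i fun j => (q j).2))
    (Set.range fun a : Fin n => (φ a, Omega.gen V a)) p}

/-- `V` is `τ`-full: the two relational morphisms coincide for every `A`-generated algebra from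
`U`, for every finite alphabet `A`. -/
def IsFull (τ : ImplicitSignature U) {V : Set (FinAlg σ)} (hVU : V ⊆ U) : Prop :=
  ∀ (n : ℕ) (S : FinAlg σ) (hS : S ∈ U) (φ : Fin n → S.Carrier), Generates S φ →
    τ.muBar hVU S hS φ = τ.muTau hVU S hS φ

end ImplicitSignature

/-! ### Constrained systems of equations, reducibility and tameness -/

/-- A system of `U`-equations in finitely many variables with clopen constraints in `Ω_A U`, where
`A` is a finite alphabet. -/
structure ConstrainedSystem {σ : Signature} (U : Set (FinAlg σ)) where
  /-- the number of letters of the alphabet of the constraints -/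
  letters : ℕ
  admissible : Admissible σ letters
  /-- the number of variables -/
  vars : ℕ
  /-- the equations -/
  equations : Set (Omega U vars × Omega U vars)
  /-- the constraints -/
  constraint : Fin vars → Set (Omega U letters)
  clopen : ∀ x, IsClopen (constraint x)

/-- `γ` is a solution of the constrained system in `Ω_A V`. -/
def ConstrainedSystem.IsSolution {σ : Signature} {U V : Set (FinAlg σ)} (E : ConstrainedSystem U)
    (hVU : V ⊆ U) (γ : Fin E.vars → Omega U E.letters) : Prop :=
  (∀ x, γ x ∈ E.constraint x) ∧
  ∀ e ∈ E.equations,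
    (e.1.subst subset_rfl γ).proj hVU = (e.2.subst subset_rfl γ).proj hVU

namespace ImplicitSignature

variable {σ : Signature} {U : Set (FinAlg σ)}

/-- `V` is `τ`-reducible with respect to a class of constrained systems. -/
def IsReducible (τ : ImplicitSignature U) {V : Set (FinAlg σ)} (hVU : V ⊆ U)
    (C : Set (ConstrainedSystem U)) : Prop :=
  ∀ E ∈ C, (∃ γ, E.IsSolution hVU γ) →
    ∃ γ', E.IsSolution hVU γ' ∧ ∀ x, γ' x ∈ τ.omegaTau subset_rfl E.letters

/-- `V` is `τ`-tame with respect to a class of constrained systems. -/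
def IsTame [Primcodable σ.Op] (τ : ImplicitSignature U) [Primcodable τ.Op]
    {V : Set (FinAlg σ)} (hVU : V ⊆ U) (C : Set (ConstrainedSystem U)) : Prop :=
  IsRecEnum V ∧ τ.IsReducible hVU C ∧
    ∀ n : ℕ, Admissible σ n → τ.DecidableWordProblem hVU n

/-- The class of all finite constrained systems of equations of `τ`-terms. -/
def termSystems (τ : ImplicitSignature U) : Set (ConstrainedSystem U) :=
  {E | E.equations.Finite ∧ ∀ e ∈ E.equations, ∃ s t : Term τ.toSignature (Fin E.vars),
    s.eval (τ.onOmega subset_rfl E.vars) (Omega.gen U) = e.1 ∧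
    t.eval (τ.onOmega subset_rfl E.vars) (Omega.gen U) = e.2}

/-- `V` is completely `τ`-tame. -/
def IsCompletelyTame [Primcodable σ.Op] (τ : ImplicitSignature U) [Primcodable τ.Op]
    {V : Set (FinAlg σ)} (hVU : V ⊆ U) : Prop :=
  τ.IsTame hVU τ.termSystems

end ImplicitSignature

end ImplicitTame

open ImplicitTame

/-! The word problem is a clause of tameness, so only reducibility needs an argument. Let `γ` solve
a system over the alphabet `A`. By compactness of `Ω_A U`, a clopen set depends only on the values
of operations in finitely many algebras, hence all constraints are recognized by one assignment `φ :
A → S` generating some `S ∈ U` (`exists_generates_of_isClopen`). The pair formed by the value of `γ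
x` at `φ` and the projection of `γ x` to `Ω_A V` lies in `μ`, thus in `μ̄^τ` because `Ω_A V = Ω_A^τ
V`, thus in `μ^τ` by fullness. Such a pair comes from a single element `γ' x` of `Ω_A^τ U`
(`exists_mem_omegaTau_of_mem_muTau`). Equal values in `S` preserve the constraints; equal
projections preserve the equations, since `proj_subst` shows that these depend only on the
projections of the `γ x`. -/

namespace ImplicitTame

/-! ### Transport of finite algebras to standard carriers -/

/-- The structure induced on the product of the underlying sets of two algebras. -/
def Interp.prod {σ : Signature} {S T : Type} (I : Interp σ S) (J : Interp σ T) :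
    Interp σ (S × T) :=
  fun f s => (I f fun j => (s j).1, J f fun j => (s j).2)

/-- The structure of the subalgebra generated by a set. -/
def Interp.generated {σ : Signature} {T : Type} (I : Interp σ T) (X : Set T) :
    Interp σ {t // Generated I X t} :=
  fun f s => ⟨I f fun j => (s j).1, .app f _ fun j => (s j).2⟩

/-- Every finite nonempty algebra is isomorphic to one with a standard underlying set. -/
theorem exists_finAlg_equiv {σ : Signature} {T : Type} [Finite T] [Nonempty T]
    (I : Interp σ T) :
    ∃ (P : FinAlg σ) (e : P.Carrier ≃ T), ∀ (f : σ.Op) (s : Fin (σ.arity f) → P.Carrier),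
      e (P.op f s) = I f fun j => e (s j) := by
  obtain ⟨k, hk⟩ := Nat.exists_eq_succ_of_ne_zero (Nat.card_pos (α := T)).ne'
  let e : Fin (k + 1) ≃ T := (finCongr hk.symm).trans (Finite.equivFin T).symm
  exact ⟨⟨k, fun f s => e.symm (I f fun j => e (s j))⟩, e, fun f s => e.apply_symm_apply _⟩

theorem Term.generated_eval {σ : Signature} {A T : Type} (I : Interp σ T) (φ : A → T)
    (t : Term σ A) : Generated I (Set.range φ) (t.eval I φ) := by
  induction t with
  | var a => exact .base ⟨a, rfl⟩
  | app f ts ih => exact .app f _ ih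

namespace IsPseudovariety

variable {σ : Signature} {U : Set (FinAlg σ)} {n : ℕ}

/-- Every assignment in a member of a pseudovariety factors through a generating one. -/
theorem exists_generates (hU : IsPseudovariety U) (hn : Admissible σ n) {S : FinAlg σ}
    (hS : S ∈ U) (φ : Fin n → S.Carrier) :
    ∃ T ∈ U, ∃ (ψ : Fin n → T.Carrier) (h : T.Carrier → S.Carrier),
      Generates T ψ ∧ IsHom T S h ∧ ∀ a, h (ψ a) = φ a := by
  -- The value of any term shows that the generated subalgebra is nonempty, as a `FinAlg` must be.
  obtain ⟨t⟩ := hn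
  have : Nonempty {s // Generated S.op (Set.range φ) s} := ⟨⟨_, t.generated_eval S.op φ⟩⟩
  obtain ⟨T, e, he⟩ := exists_finAlg_equiv (Interp.generated S.op (Set.range φ))
  have hhom : IsHom T S fun x => (e x).1 := fun f s => congrArg Subtype.val (he f s)
  have hgen : ∀ s (hs : Generated S.op (Set.range φ) s),
      Generated T.op (Set.range fun a => e.symm ⟨φ a, .base ⟨a, rfl⟩⟩) (e.symm ⟨s, hs⟩) := by
    intro s hs
    induction hs with
    | base ht =>
      obtain ⟨a, rfl⟩ := ht
      exact .base ⟨a, rfl⟩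
    | app f ts h ih =>
      have := Generated.app (I := T.op) f _ ih
      convert this using 1
      rw [Equiv.symm_apply_eq, he]
      simp [Interp.generated]
  refine ⟨T, hU.sub T S _ hS hhom (Subtype.val_injective.comp e.injective),
    fun a => e.symm ⟨φ a, .base ⟨a, rfl⟩⟩, fun x => (e x).1, fun s => ?_, hhom, fun a => by simp⟩
  simpa using hgen (e s).1 (e s).2

/-- Because implicit operations commute with `p` and `q`, their value at `χ` determines their values
at both `φ` and `ψ`. -/
theorem exists_prod (hU : IsPseudovariety U) {S T : FinAlg σ} (hS : S ∈ U) (hT : T ∈ U)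
    (φ : Fin n → S.Carrier) (ψ : Fin n → T.Carrier) :
    ∃ P ∈ U, ∃ (χ : Fin n → P.Carrier) (p : P.Carrier → S.Carrier) (q : P.Carrier → T.Carrier),
      IsHom P S p ∧ IsHom P T q ∧ (∀ a, p (χ a) = φ a) ∧ ∀ a, q (χ a) = ψ a := by
  obtain ⟨P, e, he⟩ := exists_finAlg_equiv (Interp.prod S.op T.op)
  have hp : IsHom P S fun x => (e x).1 := fun f s => congrArg Prod.fst (he f s)
  have hq : IsHom P T fun x => (e x).2 := fun f s => congrArg Prod.snd (he f s)
  exact ⟨P, hU.prod P S T _ _ hS hT hp hq e.bijective, fun a => e.symm (φ a, ψ a), _, _, hp, hq,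
    fun a => by simp, fun a => by simp⟩

end IsPseudovariety

/-! ### Clopen sets of implicit operations -/

namespace Omega

variable {σ : Signature} {U V : Set (FinAlg σ)} {m n : ℕ}

theorem on_comp (w : Omega U n) {S T : FinAlg σ} (hS : S ∈ U) (hT : T ∈ U)
    {h : S.Carrier → T.Carrier} (hh : IsHom S T h) {φ : Fin n → S.Carrier}
    {ψ : Fin n → T.Carrier} (hψ : ∀ a, h (φ a) = ψ a) : w.on T hT ψ = h (w.on S hS φ) := by
  obtain rfl : (fun a => h (φ a)) = ψ := funext hψ
  exact w.2 ⟨S, hS⟩ ⟨T, hT⟩ h hh φ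

/-- Each instance of the homomorphism condition equates two continuous maps into a finite discrete
space. Closedness in a product of finite sets then gives compactness of `Ω_n U` by Tychonoff. -/
theorem isClosed_range_val : IsClosed {w : ∀ S : U, (Fin n → S.1.Carrier) → S.1.Carrier |
    ∀ (S T : U) (h : S.1.Carrier → T.1.Carrier), IsHom S.1 T.1 h →
      ∀ φ : Fin n → S.1.Carrier, w T (fun a => h (φ a)) = h (w S φ)} := by
  simp only [Set.ofPred_forall]
  refine isClosed_iInter fun S => isClosed_iInter fun T => isClosed_iInter fun h =>
    isClosed_iInter fun _ => isClosed_iInter fun φ => isClosed_eq ?_ ?_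
  · exact (continuous_apply _).comp (continuous_apply T)
  · exact continuous_of_discreteTopology.comp ((continuous_apply φ).comp (continuous_apply S))

instance : CompactSpace (Omega U n) :=
  isCompact_iff_compactSpace.mp isClosed_range_val.isCompact

/-- Around each point, an open set contains the operations which agree with it on finitely many
algebras. -/
theorem exists_finset_of_isOpen {K : Set (Omega U n)} (hK : IsOpen K) {w : Omega U n}
    (hw : w ∈ K) : ∃ F : Finset U, ∀ w' : Omega U n, (∀ S ∈ F, w'.1 S = w.1 S) → w' ∈ K := by
  obtain ⟨O, hO, rfl⟩ := isOpen_induced_iff.mp hK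
  obtain ⟨F, u, hu, hF⟩ := isOpen_pi_iff.mp hO w.1 hw
  refine ⟨F, fun w' h => hF fun S hS => ?_⟩
  rw [h S hS]
  exact (hu S hS).2

theorem isOpen_agree (F : Finset U) (w : Omega U n) :
    IsOpen {w' : Omega U n | ∀ S ∈ F, w'.1 S = w.1 S} := by
  have : {w' : Omega U n | ∀ S ∈ F, w'.1 S = w.1 S} =
      Subtype.val ⁻¹' ((F : Set U).pi fun S => {w.1 S}) :=
    Set.ext fun _ => Iff.rfl
  rw [this]
  -- The operations on a fixed finite algebra form a finite product of discrete spaces, so single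
  -- operations are open.
  exact (isOpen_set_pi F.finite_toSet fun _ _ => isOpen_discrete _).preimage
    continuous_subtype_val

/-- Membership in a clopen set is determined by the interpretations in finitely many algebras. -/
theorem exists_finset_of_isClopen {K : Set (Omega U n)} (hK : IsClopen K) :
    ∃ F : Finset U, ∀ w w' : Omega U n, (∀ S ∈ F, w.1 S = w'.1 S) → (w ∈ K ↔ w' ∈ K) := by
  classical
  have hloc : ∀ w : Omega U n, ∃ F : Finset U, ∀ w' : Omega U n,
      (∀ S ∈ F, w'.1 S = w.1 S) → (w' ∈ K ↔ w ∈ K) := by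
    intro w
    by_cases hw : w ∈ K
    · obtain ⟨F, hF⟩ := exists_finset_of_isOpen hK.isOpen hw
      exact ⟨F, fun w' h => iff_of_true (hF w' h) hw⟩
    · obtain ⟨F, hF⟩ := exists_finset_of_isOpen hK.compl.isOpen hw
      exact ⟨F, fun w' h => iff_of_false (hF w' h) hw⟩
  choose F hF using hloc
  obtain ⟨I, hI⟩ := isCompact_univ.elim_finite_subcover
    (fun w : Omega U n => {w' : Omega U n | ∀ S ∈ F w, w'.1 S = w.1 S})
    (fun w => isOpen_agree (F w) w) fun w _ => Set.mem_iUnion.mpr ⟨w, fun _ _ => rfl⟩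
  refine ⟨I.biUnion F, fun w w' h => ?_⟩
  -- Both `w` and `w'` agree with the centre `v` on `F v`, so each lies in `K` exactly when `v`
  -- does.
  obtain ⟨v, hv, hwv⟩ := Set.mem_iUnion₂.mp (hI (Set.mem_univ w))
  refine (hF v w hwv).trans (hF v w' fun S hS => ?_).symm
  rw [← h S (Finset.mem_biUnion.mpr ⟨v, hv, hS⟩), hwv S hS]

/-- Finitely many assignments in members of a pseudovariety are jointly controlled by one
generating assignment. -/
theorem exists_generates_forall_on_eq (hU : IsPseudovariety U) (hn : Admissible σ n)
    (F : Finset (Σ S : U, Fin n → S.1.Carrier)) :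
    ∃ (T : FinAlg σ) (hT : T ∈ U) (ψ : Fin n → T.Carrier), Generates T ψ ∧
      ∀ w w' : Omega U n, w.on T hT ψ = w'.on T hT ψ → ∀ p ∈ F, w.1 p.1 p.2 = w'.1 p.1 p.2 := by
  classical
  induction F using Finset.induction_on with
  | empty =>
    obtain ⟨S, hS⟩ := hU.nonempty
    obtain ⟨T, hT, ψ, -, hg, -, -⟩ := hU.exists_generates hn hS fun _ => 0
    exact ⟨T, hT, ψ, hg, by simp⟩
  | insert p F _ ih =>
    obtain ⟨T, hT, ψ, -, hF⟩ := ih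
    obtain ⟨P, hP, χ, p₁, p₂, h₁, h₂, e₁, e₂⟩ := hU.exists_prod p.1.2 hT p.2 ψ
    -- The paired assignment `χ` need not generate the product, so pass to the subalgebra that it
    -- generates.
    obtain ⟨Q, hQ, ξ, h, hg, hh, e⟩ := hU.exists_generates hn hP χ
    refine ⟨Q, hQ, ξ, hg, fun w w' hw => ?_⟩
    have hwP : w.on P hP χ = w'.on P hP χ := by
      rw [on_comp w hQ hP hh e, on_comp w' hQ hP hh e, hw]
    rw [Finset.forall_mem_insert]
    constructor
    · change w.on _ p.1.2 p.2 = w'.on _ p.1.2 p.2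
      rw [on_comp w hP p.1.2 h₁ e₁, on_comp w' hP p.1.2 h₁ e₁, hwP]
    · exact hF w w' (by rw [on_comp w hP hT h₂ e₂, on_comp w' hP hT h₂ e₂, hwP])

/-- Finitely many clopen sets are recognized by one generated member of the pseudovariety. -/
theorem exists_generates_of_isClopen (hU : IsPseudovariety U) (hn : Admissible σ n)
    {ι : Type} [Fintype ι] {K : ι → Set (Omega U n)} (hK : ∀ x, IsClopen (K x)) :
    ∃ (T : FinAlg σ) (hT : T ∈ U) (ψ : Fin n → T.Carrier), Generates T ψ ∧
      ∀ w w' : Omega U n, w.on T hT ψ = w'.on T hT ψ → ∀ x, w ∈ K x ↔ w' ∈ K x := by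
  classical
  choose F hF using fun x => exists_finset_of_isClopen (hK x)
  obtain ⟨T, hT, ψ, hg, hw⟩ := exists_generates_forall_on_eq hU hn
    -- All assignments in the relevant algebras: there are finitely many, and together they
    -- determine the whole operations `w_S`.
    ((Finset.univ.biUnion F).sigma fun _ => Finset.univ)
  refine ⟨T, hT, ψ, hg, fun w w' h x => hF x w w' fun S hS => funext fun φ => ?_⟩
  refine hw w w' h ⟨S, φ⟩ (Finset.mem_sigma.mpr ⟨?_, Finset.mem_univ _⟩)
  exact Finset.mem_biUnion.mpr ⟨x, Finset.mem_univ _, hS⟩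

theorem proj_subst (hVU : V ⊆ U) (u : Omega U m) (γ : Fin m → Omega U n) :
    (u.subst subset_rfl γ).proj hVU = u.subst hVU fun x => (γ x).proj hVU :=
  rfl

end Omega

/-! ### Fullness implies reducibility -/

namespace ImplicitSignature

variable {σ : Signature} {U V : Set (FinAlg σ)} {n : ℕ}

/-- Each pair in `μ^τ` is witnessed by an element of `Ω_n^τ U`. -/
theorem exists_mem_omegaTau_of_mem_muTau (τ : ImplicitSignature U) (hVU : V ⊆ U) {S : FinAlg σ}
    (hS : S ∈ U) (φ : Fin n → S.Carrier) {p : S.Carrier × Omega V n}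
    (hp : p ∈ τ.muTau hVU S hS φ) :
    ∃ w ∈ τ.omegaTau subset_rfl n, w.on S hS φ = p.1 ∧ w.proj hVU = p.2 := by
  induction hp with
  | base ht =>
    obtain ⟨a, rfl⟩ := ht
    exact ⟨Omega.gen U a, .base ⟨a, rfl⟩, rfl, rfl⟩
  | app f ts h ih =>
    choose w hw h₁ h₂ using ih
    -- Evaluation at `φ` and projection to `Ω_n V` both commute with the operations of `τ`, so one
    -- witness serves both coordinates.
    refine ⟨τ.onOmega subset_rfl n f w, .app f w hw, ?_, ?_⟩
    · exact congrArg (τ.onAlg S hS f) (funext h₁)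
    · exact congrArg (τ.onOmega hVU n f) (funext h₂)

/-- If `V` is `τ`-full and `Ω_n V = Ω_n^τ V` for all `n`, then `V` is `τ`-reducible with respect to
every class of constrained systems. -/
theorem IsFull.isReducible {τ : ImplicitSignature U} {hVU : V ⊆ U} (hfull : τ.IsFull hVU)
    (hU : IsPseudovariety U) (heq : ∀ n : ℕ, Admissible σ n → τ.omegaTau hVU n = Set.univ)
    (C : Set (ConstrainedSystem U)) : τ.IsReducible hVU C := by
  rintro E - ⟨γ, hγ, hE⟩
  obtain ⟨S, hS, φ, hg, hrec⟩ := Omega.exists_generates_of_isClopen hU E.admissible E.clopen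
  have hmem : ∀ x, ((γ x).on S hS φ, (γ x).proj hVU) ∈ τ.muTau hVU S hS φ := fun x => by
    rw [← hfull E.letters S hS φ hg]
    exact ⟨⟨γ x, rfl, rfl⟩, by rw [heq _ E.admissible]; trivial⟩
  choose γ' hτ h₁ h₂ using fun x => τ.exists_mem_omegaTau_of_mem_muTau hVU hS φ (hmem x)
  refine ⟨γ', ⟨fun x => (hrec _ _ (h₁ x) x).mpr (hγ x), fun e he => ?_⟩, hτ⟩
  have := hE e he
  simp only [Omega.proj_subst] at this ⊢
  simpa only [h₂] using this

end ImplicitSignature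

end ImplicitTame

theorem propositionp {σ : Signature} [Finite σ.Op] [Primcodable σ.Op]
    {U V : Set (FinAlg σ)} (hU : IsPseudovariety U) (hV : IsPseudovariety V) (hVU : V ⊆ U)
    (hre : IsRecEnum V)
    (τ : ImplicitSignature U) [Primcodable τ.Op] (hτ : τ.IsComputable)
    (heq : ∀ n : ℕ, Admissible σ n → τ.omegaTau hVU n = Set.univ)
    (hfull : τ.IsFull hVU) :
    τ.IsCompletelyTame hVU ↔ ∀ n : ℕ, Admissible σ n → τ.DecidableWordProblem hVU n :=
  ⟨fun h => h.2.2, fun h => ⟨hre, hfull.isReducible hU heq _, h⟩⟩
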